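/- Let $N\in\mathbb N$ and let $S^2$ carry the rotation-invariant symplectic form $\omega$ of total area $2\pi N$, with moment map $\mu$ the (rescaled) height function, moment polytope $P=[0,N]$, and action-angle coordinates $(x,\theta)$ on $\check M=\mu^{-1}((0,N))$, $\omega=dx\wedge d\theta$. Let $L$ be the prequantum line bundle (degree $N$), with its Hermitian structure and connection, and let $\mathbb 1$ be the unitary frame of $L$ over $\check M$ with $\nabla\mathbb 1=-i\,x\,d\theta\otimes\mathbb 1$ which extends smoothly over $\mu^{-1}(0)$. Let $g_P(x)=\tfrac12x\log x+\tfrac12(N-x)\log(N-x)$. Let $m\in\mathbb R$ and $\alpha>0$ with $0<m-\alpha$ and $m+\alpha<N$, and put $S=[m-\alpha,m+\alpha]$, $P_1=[0,m-\alpha]$, $P_2=[m+\alpha,N]$. Let $\psi\in C^\infty([0,N])$ be such that $\psi''\ge 0$, $\psi''$ is even about $m$, attains its maximum at $m$, and has support $S$. For $s\ge0$ let $g_s=g_P+s\psi$ (the Mabuchi ray), let $J_s$ be the complex structure with holomorphic coordinate $w_s=e^{g_s'(x)+i\theta}$ on $\check M$, and let $h_s(x)=x\,g_s'(x)-g_s(x)$.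 For $n\in P\cap\mathbb Z$ let $\sigma_s^n=e^{-h_s(x)}w_s^n\,\mathbb 1$, extended by continuity to the two poles. Then, for all $s\ge 0$ and $n\in P\cap\mathbb Z$, $\sigma_s^n$ is a smooth global section of $L$ and is $J_s$-holomorphic on $\check M$. Put $\xi_s^n=\sigma_s^n/\|\sigma_s^n\|_{L^1(S^2)}$, the norm being taken with respect to the Liouville measure. For $U\subset S^2$ open, regard a section $u$ of $L$ as the distributional section $\iota(u)(\tau)=\int_U u\,\tau\,\omega$, $\tau\in C_c^\infty(L^{-1}|_U)$. Then for every open $U\subset S^2$ and every $n\in P\cap\mathbb Z$, as $s\to\infty$ and in the weak-$*$ sense (that is, after evaluation at each $\tau\in C^\infty_c(L^{-1}|_U)$): (a) if $n$ lies in the interior of $S$, then $\iota(\xi_s^n)\to\delta^n$, where $\delta^n(\tau)=\frac1{2\pi}\int_0^{2\pi}e^{in\theta}\,\tau(n,\theta)\,d\theta$, with $\tau(x,\theta)$ the coefficient of $\tau$ (extended by zero) in the frame $\mathbb 1^{-1}$; (b) if $n\in P_j$, $j=1,2$, then $\iota(\xi_s^n)\to\iota\!\left(\dfrac{\chi_{\mu^{-1}(P_j)}\,\sigma_0^n}{\|\sigma_0^n\|_{L^1(\mu^{-1}(P_j))}}\right)$.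 -/

import Mathlib

open Set Filter Topology MeasureTheory
open scoped ContDiff Manifold

noncomputable section

namespace ToricSphere

/-! ### The sphere, its moment map and action-angle coordinates -/

instance : Fact (Module.finrank ℝ (EuclideanSpace ℝ (Fin 3)) = 2 + 1) :=
  ⟨by simp⟩

/-- The two-sphere, with the topology, Borel structure and smooth structure given by Mathlib. -/
abbrev S2 : Type := Metric.sphere (0 : EuclideanSpace ℝ (Fin 3)) 1

/-- The point of the sphere with height `c` and azimuth `θ`. -/
def spherePoint (c : Icc (-1 : ℝ) 1) (θ : ℝ) : S2 :=
  ⟨!₂[√(1 - (c : ℝ) ^ 2) * Real.cos θ, √(1 - (c : ℝ) ^ 2) * Real.sin θ, (c : ℝ)], by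
    have hc : 0 ≤ 1 - (c : ℝ) ^ 2 := by nlinarith [c.2.1, c.2.2]
    have h := Real.sq_sqrt hc
    have h' := Real.sin_sq_add_cos_sq θ
    rw [mem_sphere_zero_iff_norm, EuclideanSpace.norm_eq, Real.sqrt_eq_one]
    simp only [Real.norm_eq_abs, sq_abs, Fin.sum_univ_three]
    simp
    nlinarith⟩

/-- The pole of height `1`. -/
def north : S2 := spherePoint ⟨1, by norm_num, by norm_num⟩ 0

/-- The pole of height `-1`. -/
def south : S2 := spherePoint ⟨-1, by norm_num, by norm_num⟩ 0

/-- The moment map of the rotation action about the vertical axis, for the symplectic form of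
total area `2πN`: the height function, rescaled to have image `[0, N]`. -/
def moment (N : ℕ) (p : S2) : ℝ := N * (1 + p.1 2) / 2

/-- The dense open subset where the circle action is free. -/
def openOrbit : Set S2 := {p | p ≠ south ∧ p ≠ north}

/-- `e^{iθ}`, where `θ` is the angle coordinate; meaningful on `openOrbit`. -/
def phase (p : S2) : ℂ :=
  ((p.1 0 : ℂ) + Complex.I * (p.1 1 : ℂ)) / (‖(p.1 0 : ℂ) + Complex.I * (p.1 1 : ℂ)‖ : ℂ)

/-- Action-angle coordinates: for `0 < x < N` this is the point of `openOrbit` with moment map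
value `x` and angle `θ` (heights are clamped to `[-1, 1]` to make the function total). -/
def actionAngle (N : ℕ) (x θ : ℝ) : S2 :=
  spherePoint (projIcc (-1) 1 (by norm_num) (2 * x / N - 1)) θ

/-- The Liouville measure of `ω`: it is `dx dθ` in action-angle coordinates (where
`ω = dx ∧ dθ`), and the two poles are null. -/
def liouville (N : ℕ) : Measure S2 :=
  Measure.map (fun q : ℝ × ℝ => actionAngle N q.1 q.2)
    (volume.restrict (Ioo (0 : ℝ) N ×ˢ Ioo (0 : ℝ) (2 * Real.pi)))

/-! ### The prequantum line bundle and its dual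

The prequantum line bundle `L` is given by two unitary frames, `e₀` over the complement of
`north` and `e₁` over the complement of `south`, with `e₁ = e^{iNθ} e₀` over `openOrbit`, and
with the connection `∇ e₀ = -i x dθ ⊗ e₀` (so that `∇ e₁ = i (N - x) dθ ⊗ e₁`), whose curvature is
`-iω`. Its `k`-fold analogue (`e₁ = e^{ikθ} e₀`) is the line bundle of degree `k`: `L` has degree
`k = N`, and `L⁻¹`, with the dual frames, has degree `k = -N`.

A (set-theoretic) section is written as a function `u : S2 → ℂ`: for `p ≠ north`, `u p` is the
coefficient at `p` in the frame `e₀`, and `u north` is the coefficient at `north` in the frame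
`e₁`. Thus the pointwise norm of a section `u` is `‖u p‖`, and the pointwise pairing of a section
`u` of `L` with a section `τ` of `L⁻¹` is `u p * τ p`. The frame `e₀` restricted to
`openOrbit` is the trivializing unitary frame in which the monomial sections are written. -/

/-- The coefficient in the frame `e₁` of a section of the line bundle of degree `k`; meaningful
on the complement of `south`. -/
def northCoeff (k : ℤ) (u : S2 → ℂ) (p : S2) : ℂ :=
  open Classical in if p = north then u p else phase p ^ (-k) * u p

/-- Smooth global sections of the line bundle of degree `k`: the coefficients in both frames are
smooth where the frames are defined. -/
def IsSmoothSection (k : ℤ) (u : S2 → ℂ) : Prop :=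
  ContMDiffOn (𝓡 2) 𝓘(ℝ, ℂ) ∞ u {north}ᶜ ∧
    ContMDiffOn (𝓡 2) 𝓘(ℝ, ℂ) ∞ (northCoeff k u) {south}ᶜ

/-- Smooth sections of `L⁻¹` with compact support in `U`, extended by zero to the sphere. -/
structure TestSection (N : ℕ) (U : Set S2) where
  toFun : S2 → ℂ
  smooth : IsSmoothSection (-(N : ℤ)) toFun
  supp : tsupport toFun ⊆ U

/-- The distributional section over `U` defined by a section `u` of `L`. -/
def iota (N : ℕ) (U : Set S2) (u : S2 → ℂ) (τ : TestSection N U) : ℂ :=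
  ∫ p in U, u p * τ.toFun p ∂(liouville N)

/-- The `L¹` norm of a section over a subset `A` of the sphere. -/
def l1Norm (N : ℕ) (A : Set S2) (u : S2 → ℂ) : ℝ :=
  ∫ p in A, ‖u p‖ ∂(liouville N)

/-- The Dirac distributional section `δⁿ` supported on the circle over the integral point `n`
(`0 < n < N`): the Fourier coefficient of frequency `-n` of `τ` along that circle. -/
def dirac (N : ℕ) (U : Set S2) (n : ℤ) (τ : TestSection N U) : ℂ :=
  (1 / (2 * Real.pi) : ℂ) * ∫ θ in (0 : ℝ)..(2 * Real.pi),
    Complex.exp (Complex.I * n * θ) * τ.toFun (actionAngle N n θ)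

/-! ### Symplectic potentials and monomial sections -/

/-- The canonical symplectic potential of the polytope `[0, N]`. -/
def gP (N : ℕ) (x : ℝ) : ℝ :=
  1 / 2 * (x * Real.log x) + 1 / 2 * ((N - x) * Real.log (N - x))

/-- The symplectic potentials `g_s = g_P + s ψ` of the Mabuchi ray. -/
def gRay (N : ℕ) (ψ : ℝ → ℝ) (s x : ℝ) : ℝ := gP N x + s * ψ x

/-- The Kähler potential `h = x y - g`, `y = g'(x)`, as a function of `x ∈ (0, N)`. -/
def kahlerPotential (g : ℝ → ℝ) (x : ℝ) : ℝ := x * deriv g x - g x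

/-- The holomorphic coordinate `w = e^{y + iθ}`, `y = g'(x)`, on `openOrbit`. -/
def holCoord (N : ℕ) (g : ℝ → ℝ) (p : S2) : ℂ :=
  Complex.exp (deriv g (moment N p) : ℝ) * phase p

/-- The coefficient of `e^{-h} wⁿ` in the trivializing unitary frame over `openOrbit`. -/
def monomialCoeff (N : ℕ) (g : ℝ → ℝ) (n : ℤ) (p : S2) : ℂ :=
  Complex.exp (-(kahlerPotential g (moment N p) : ℝ)) * holCoord N g p ^ n

/-- The monomial section of `L` that is `e^{-h} wⁿ` over `openOrbit`, extended by continuity to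
the two poles (in the frame `e₀` at `south`, in the frame `e₁` at `north`). -/
def monomialSection (N : ℕ) (g : ℝ → ℝ) (n : ℤ) (p : S2) : ℂ :=
  open Classical in
  if p = south then limUnder (𝓝[≠] south) (monomialCoeff N g n)
  else if p = north then limUnder (𝓝[≠] north) (northCoeff N (monomialCoeff N g n))
  else monomialCoeff N g n p

/-- A section `u` of `L` is holomorphic over `openOrbit` for the complex structure with symplectic
potential `g`, that is, `∇_{∂/∂z̄} u = 0` for the complex coordinate `z = g'(x) + iθ`. Here
`2 ∂/∂z̄ = g''(x)⁻¹ ∂/∂x + i ∂/∂θ` and, in the frame `e₀`, `∇ = d - i x dθ`. For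
smooth sections on the sphere this implies holomorphy at the poles too. -/
def IsHolomorphicSection (N : ℕ) (g : ℝ → ℝ) (u : S2 → ℂ) : Prop :=
  ∀ x ∈ Ioo (0 : ℝ) N, ∀ θ : ℝ,
    (((deriv (deriv g) x)⁻¹ : ℝ) : ℂ) * deriv (fun x' : ℝ => u (actionAngle N x' θ)) x
      + Complex.I * (deriv (fun θ' : ℝ => u (actionAngle N x θ')) θ
        - Complex.I * x * u (actionAngle N x θ)) = 0

/-- The `J_s`-holomorphic monomial section `σ_s^n`. -/
def sigma (N : ℕ) (ψ : ℝ → ℝ) (s : ℝ) (n : ℤ) : S2 → ℂ :=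
  monomialSection N (gRay N ψ s) n

/-- The `L¹`-normalized monomial section `ξ_s^n`. -/
def xi (N : ℕ) (ψ : ℝ → ℝ) (s : ℝ) (n : ℤ) : S2 → ℂ :=
  fun p => sigma N ψ s n p / (l1Norm N univ (sigma N ψ s n) : ℂ)

/-- The restriction of `σ_0^n` to `μ⁻¹(Q)`, extended by zero and normalized to have `L¹` norm
one. -/
def normalizedRestriction (N : ℕ) (ψ : ℝ → ℝ) (n : ℤ) (Q : Set ℝ) : S2 → ℂ :=
  fun p => (moment N ⁻¹' Q).indicator (sigma N ψ 0 n) p /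
    (l1Norm N (moment N ⁻¹' Q) (sigma N ψ 0 n) : ℂ)

/-- The second derivative on the moment polytope `[0, N]` (one-sided at the endpoints). -/
def secondDeriv (N : ℕ) (ψ : ℝ → ℝ) (x : ℝ) : ℝ :=
  iteratedDerivWithin 2 ψ (Icc (0 : ℝ) N) x

/-- `ψ` is smooth on `[0, N]` and `ψ''` is a bump function, even about `m`, with maximum at `m`
and with support `[m - α, m + α]`, which is contained in the interior of `[0, N]`. -/
structure IsBumpPotential (N : ℕ) (m α : ℝ) (ψ : ℝ → ℝ) : Prop where
  radius_pos : 0 < α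
  left_mem : 0 < m - α
  right_mem : m + α < N
  smooth : ContDiffOn ℝ ∞ ψ (Icc (0 : ℝ) N)
  nonneg : ∀ x ∈ Icc (0 : ℝ) N, 0 ≤ secondDeriv N ψ x
  even : ∀ t : ℝ, m + t ∈ Icc (0 : ℝ) N → m - t ∈ Icc (0 : ℝ) N →
    secondDeriv N ψ (m + t) = secondDeriv N ψ (m - t)
  max : ∀ x ∈ Icc (0 : ℝ) N, secondDeriv N ψ x ≤ secondDeriv N ψ m
  supp : closure {x ∈ Icc (0 : ℝ) N | secondDeriv N ψ x ≠ 0} = Icc (m - α) (m + α)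

end ToricSphere

end

/-!
Write `n = k` and `N = k + l` with natural numbers `k`, `l`. In action-angle coordinates the
logarithms in `g_P` combine so that the monomial section is
`√x ^ k * √(N - x) ^ l * exp (s F(x)) * e^{ikθ}` with `F(x) = (k - x) ψ'(x) + ψ(x)`
(`sigma_actionAngle`). As a function on the sphere, `√x e^{iθ}` is the product of the complex
horizontal coordinate and a positive smooth function off the north pole, and symmetrically for
`√(N - x) e^{-iθ}` off the south pole. This gives smoothness, the values at the poles being limits
of the closed forms (`isSmoothSection_sigma`). The amplitude `a` satisfies `a' = (k - x) g_s'' a`,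
which is the holomorphy equation.

The asymptotics are governed by `F' = (k - x) ψ''`: the function `F` increases before `k` and
decreases after `k`, strictly across every interval that meets the support of `ψ''`. If `k` lies in
the interior of the support, it is the unique maximum point of `F`, and Laplace's principle
(`tendsto_setIntegral_exp_smul_of_unique_maximum`) concentrates both the pairing with a test
section and the `L¹` norm on the circle over `k`. If `k` lies in one of the two complementary
intervals, `F` is maximal exactly on that interval, and after division by the maximum of
`exp (s F)` the weights converge boundedly to its indicator (`tendsto_integral_exp_smul_of_le`).
In both cases the rescaling cancels in the quotient of pairing and norm.
-/

namespace ToricSphere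

/-! ### Coordinates on the sphere -/

/-- The horizontal coordinates of a point of the sphere, as a complex number. -/
noncomputable def planar (p : S2) : ℂ := (p.1 0 : ℂ) + Complex.I * (p.1 1 : ℂ)

theorem phase_eq (p : S2) : phase p = planar p / (‖planar p‖ : ℂ) := rfl

theorem coord_sq_sum (p : S2) : p.1 0 ^ 2 + p.1 1 ^ 2 + p.1 2 ^ 2 = 1 := by
  have h := mem_sphere_zero_iff_norm.1 p.2
  rw [EuclideanSpace.norm_eq, Real.sqrt_eq_one] at h
  simpa [Fin.sum_univ_three] using h

theorem norm_planar_sq (p : S2) : ‖planar p‖ ^ 2 = (1 - p.1 2) * (1 + p.1 2) := by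
  have h := coord_sq_sum p
  rw [← Complex.normSq_eq_norm_sq, planar, mul_comm Complex.I, Complex.normSq_add_mul_I]
  linarith

theorem norm_planar (p : S2) : ‖planar p‖ = √((1 - p.1 2) * (1 + p.1 2)) := by
  rw [← norm_planar_sq, Real.sqrt_sq (norm_nonneg _)]

theorem height_mem (p : S2) : p.1 2 ∈ Icc (-1 : ℝ) 1 := by
  have h := coord_sq_sum p
  constructor <;> nlinarith [sq_nonneg (p.1 0), sq_nonneg (p.1 1)]

theorem eq_north_of_height {p : S2} (h : p.1 2 = 1) : p = north := by
  have hs := coord_sq_sum p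
  have h0 : p.1 0 = 0 := by nlinarith [sq_nonneg (p.1 0), sq_nonneg (p.1 1)]
  have h1 : p.1 1 = 0 := by nlinarith [sq_nonneg (p.1 0), sq_nonneg (p.1 1)]
  ext i
  fin_cases i <;> simp [north, spherePoint, h0, h1, h]

theorem eq_south_of_height {p : S2} (h : p.1 2 = -1) : p = south := by
  have hs := coord_sq_sum p
  have h0 : p.1 0 = 0 := by nlinarith [sq_nonneg (p.1 0), sq_nonneg (p.1 1)]
  have h1 : p.1 1 = 0 := by nlinarith [sq_nonneg (p.1 0), sq_nonneg (p.1 1)]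
  ext i
  fin_cases i <;> simp [south, spherePoint, h0, h1, h]

theorem height_lt_one {p : S2} (h : p ≠ north) : p.1 2 < 1 :=
  lt_of_le_of_ne (height_mem p).2 fun h' => h (eq_north_of_height h')

theorem neg_one_lt_height {p : S2} (h : p ≠ south) : -1 < p.1 2 :=
  lt_of_le_of_ne (height_mem p).1 fun h' => h (eq_south_of_height h'.symm)

theorem south_ne_north : south ≠ north := by
  intro h
  have := congrArg (fun p : S2 => p.1 2) h
  simp only [south, north, spherePoint, Matrix.cons_val] at this
  norm_num at this

theorem planar_ne_zero {p : S2} (hs : p ≠ south) (hn : p ≠ north) : planar p ≠ 0 := by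
  intro h
  have h2 := norm_planar_sq p
  rw [h, norm_zero] at h2
  nlinarith [height_lt_one hn, neg_one_lt_height hs]

theorem norm_phase {p : S2} (hs : p ≠ south) (hn : p ≠ north) : ‖phase p‖ = 1 := by
  have := norm_ne_zero_iff.2 (planar_ne_zero hs hn)
  rw [phase_eq, norm_div, Complex.norm_real, norm_norm, div_self this]

theorem phase_ne_zero {p : S2} (hs : p ≠ south) (hn : p ≠ north) : phase p ≠ 0 := by
  rw [← norm_ne_zero_iff, norm_phase hs hn]; exact one_ne_zero

theorem moment_mem (N : ℕ) (p : S2) : moment N p ∈ Icc (0 : ℝ) N := by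
  have h := height_mem p
  have hN : (0 : ℝ) ≤ N := N.cast_nonneg
  constructor
  · unfold moment; nlinarith [h.1]
  · unfold moment; nlinarith [h.2]

theorem moment_mem_Ioo {N : ℕ} (hN : 0 < N) {p : S2} (hs : p ≠ south) (hn : p ≠ north) :
    moment N p ∈ Ioo (0 : ℝ) N := by
  have hN : (0 : ℝ) < N := by exact_mod_cast hN
  have h1 := height_lt_one hn
  have h2 := neg_one_lt_height hs
  constructor
  · unfold moment; nlinarith
  · unfold moment; nlinarith

section ActionAngle

variable {N : ℕ} {x : ℝ} (θ : ℝ)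

theorem height_actionAngle (hx : x ∈ Icc (0 : ℝ) N) (hN : 0 < N) :
    (actionAngle N x θ).1 2 = 2 * x / N - 1 := by
  have hN : (0 : ℝ) < N := by exact_mod_cast hN
  have hm : 2 * x / N - 1 ∈ Icc (-1 : ℝ) 1 := by
    constructor
    · have := div_nonneg (mul_nonneg zero_le_two hx.1) hN.le
      linarith
    · have : 2 * x / N ≤ 2 := by rw [div_le_iff₀ hN]; linarith [hx.2]
      linarith
  simp [actionAngle, spherePoint, projIcc_of_mem _ hm]

theorem moment_actionAngle (hx : x ∈ Icc (0 : ℝ) N) (hN : 0 < N) :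
    moment N (actionAngle N x θ) = x := by
  have hN' : (N : ℝ) ≠ 0 := by positivity
  rw [moment, height_actionAngle θ hx hN]
  field_simp
  ring

theorem actionAngle_ne_poles (hx : x ∈ Ioo (0 : ℝ) N) (hN : 0 < N) :
    actionAngle N x θ ≠ south ∧ actionAngle N x θ ≠ north := by
  have hN' : (N : ℝ) ≠ 0 := by positivity
  have h := moment_actionAngle θ (Ioo_subset_Icc_self hx) hN
  constructor
  · intro h'
    rw [h'] at h
    simp [moment, south, spherePoint] at h
    exact hx.1.ne h
  · intro h'
    rw [h'] at h
    simp [moment, north, spherePoint] at h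
    have := hx.2
    linarith

theorem phase_actionAngle (hx : x ∈ Ioo (0 : ℝ) N) (hN : 0 < N) :
    phase (actionAngle N x θ) = Complex.exp (Complex.I * θ) := by
  obtain ⟨hs, hn⟩ := actionAngle_ne_poles θ hx hN
  set c := projIcc (-1 : ℝ) 1 (by norm_num) (2 * x / N - 1) with hc
  have hp : planar (actionAngle N x θ)
      = ((√(1 - (c : ℝ) ^ 2) : ℝ) : ℂ) * Complex.exp (Complex.I * θ) := by
    rw [mul_comm Complex.I, Complex.exp_mul_I, ← Complex.ofReal_cos, ← Complex.ofReal_sin]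
    simp [planar, actionAngle, spherePoint, ← hc]
    ring
  have hn' := planar_ne_zero hs hn
  rw [phase_eq, hp] at *
  rw [norm_mul, mul_comm Complex.I, Complex.norm_exp_ofReal_mul_I, mul_one, Complex.norm_real,
    Real.norm_of_nonneg (Real.sqrt_nonneg _)]
  exact mul_div_cancel_left₀ _ (left_ne_zero_of_mul hn')

end ActionAngle

theorem continuous_actionAngle (N : ℕ) :
    Continuous fun q : ℝ × ℝ => actionAngle N q.1 q.2 := by
  have hc : Continuous fun q : ℝ × ℝ =>
      ((projIcc (-1 : ℝ) 1 (by norm_num) (2 * q.1 / N - 1) : Icc (-1 : ℝ) 1) : ℝ) :=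
    continuous_subtype_val.comp (continuous_projIcc.comp (by fun_prop))
  refine Continuous.subtype_mk ?_ _
  refine (PiLp.continuous_toLp 2 _).comp (continuous_pi fun i => ?_)
  fin_cases i
  · exact ((continuous_const.sub (hc.pow 2)).sqrt).mul (Real.continuous_cos.comp continuous_snd)
  · exact ((continuous_const.sub (hc.pow 2)).sqrt).mul (Real.continuous_sin.comp continuous_snd)
  · exact hc

theorem contMDiff_coord (i : Fin 3) :
    ContMDiff (𝓡 2) 𝓘(ℝ, ℝ) ∞ fun p : S2 => p.1 i :=
  (EuclideanSpace.proj i : EuclideanSpace ℝ (Fin 3) →L[ℝ] ℝ).contDiff.contMDiff.comp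
    (contMDiff_coe_sphere (n := 2) (E := EuclideanSpace ℝ (Fin 3)))

theorem contMDiff_planar : ContMDiff (𝓡 2) 𝓘(ℝ, ℂ) ∞ planar := by
  have h : ContDiff ℝ ∞ fun q : ℝ × ℝ => (q.1 : ℂ) + Complex.I * (q.2 : ℂ) :=
    (Complex.ofRealCLM.contDiff.comp contDiff_fst).add
      (contDiff_const.mul (Complex.ofRealCLM.contDiff.comp contDiff_snd))
  exact h.contMDiff.comp ((contMDiff_coord 0).prodMk_space (contMDiff_coord 1))

theorem contMDiff_moment (N : ℕ) : ContMDiff (𝓡 2) 𝓘(ℝ, ℝ) ∞ (moment N) := by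
  have h : ContDiff ℝ ∞ fun z : ℝ => N * (1 + z) / 2 := by fun_prop
  exact h.contMDiff.comp (contMDiff_coord 2)

instance : Nontrivial S2 := ⟨⟨south, north, south_ne_north⟩⟩

/-- Connectedness makes the punctured neighbourhoods of the poles nontrivial, so that limits along
them are unique. -/
instance : ConnectedSpace S2 := by
  refine isConnected_iff_connectedSpace.1 (isConnected_sphere ?_ _ zero_le_one)
  rw [rank_eq_card_basis (EuclideanSpace.basisFun (Fin 3) ℝ).toBasis]
  simp

/-! ### The monomial sections in closed form -/

/-- The coefficient of `s` in the exponent `(n - x) g_s'(x) + g_s(x)` of the monomial section,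
with the one-sided derivative of `ψ` at the endpoints of `[0, N]`. -/
noncomputable def exponent (N : ℕ) (ψ : ℝ → ℝ) (n x : ℝ) : ℝ :=
  (n - x) * derivWithin ψ (Icc (0 : ℝ) N) x + ψ x

/-- The pointwise norm of the monomial section of weight `k` as a function of `x`, where
`k + l = N`. -/
noncomputable def amplitude (N : ℕ) (ψ : ℝ → ℝ) (k l : ℕ) (s x : ℝ) : ℝ :=
  √x ^ k * √(N - x) ^ l * Real.exp (s * exponent N ψ k x)

theorem hasDerivAt_gRay {N : ℕ} {ψ : ℝ → ℝ} (hψ : ContDiffOn ℝ ∞ ψ (Icc (0 : ℝ) N)) (s : ℝ) {x : ℝ}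
    (hx : x ∈ Ioo (0 : ℝ) N) :
    HasDerivAt (gRay N ψ s) (1 / 2 * (Real.log x - Real.log (N - x))
      + s * derivWithin ψ (Icc (0 : ℝ) N) x) x := by
  have h0 : x ≠ 0 := hx.1.ne'
  have h1 : (N : ℝ) - x ≠ 0 := by have := hx.2; intro h; linarith
  have hψ' : HasDerivAt ψ (derivWithin ψ (Icc (0 : ℝ) N) x) x :=
    ((hψ.differentiableOn (by simp) x (Ioo_subset_Icc_self hx)).hasDerivWithinAt).hasDerivAt
      (Icc_mem_nhds hx.1 hx.2)
  have hs : HasDerivAt (fun x : ℝ => (N : ℝ) - x) (-1) x := by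
    simpa using (hasDerivAt_id x).const_sub (N : ℝ)
  have h := ((((hasDerivAt_id x).mul (Real.hasDerivAt_log h0)).const_mul (1 / 2)).add
    ((hs.mul (hs.log h1)).const_mul (1 / 2))).add (hψ'.const_mul s)
  refine h.congr_deriv ?_
  simp only [id]
  field_simp
  ring

section Coefficient

variable {N : ℕ} {ψ : ℝ → ℝ} (hψ : ContDiffOn ℝ ∞ ψ (Icc (0 : ℝ) N)) (hN : 0 < N)
  {k l : ℕ} (hkl : k + l = N) (s : ℝ)
include hψ hN hkl

theorem monomialCoeff_eq {p : S2} (hs : p ≠ south) (hn : p ≠ north) :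
    monomialCoeff N (gRay N ψ s) k p = (amplitude N ψ k l s (moment N p) : ℂ) * phase p ^ k := by
  have hx := moment_mem_Ioo hN hs hn
  set x := moment N p
  have hx' : 0 < (N : ℝ) - x := by linarith [hx.2]
  have hsqrt {y : ℝ} (hy : 0 < y) : √y = Real.exp (Real.log y / 2) := by
    rw [Real.exp_half, Real.exp_log hy]
  have hexp : amplitude N ψ k l s x
      = Real.exp (-kahlerPotential (gRay N ψ s) x) * Real.exp (deriv (gRay N ψ s) x) ^ k := by
    have hl : (N : ℝ) = k + l := by exact_mod_cast hkl.symm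
    rw [amplitude, hsqrt hx.1, hsqrt hx', ← Real.exp_nat_mul, ← Real.exp_nat_mul, ← Real.exp_nat_mul,
      ← Real.exp_add, ← Real.exp_add, ← Real.exp_add, kahlerPotential,
      (hasDerivAt_gRay hψ s hx).deriv, gRay, gP, exponent]
    congr 1
    have hl' : (l : ℝ) = N - k := by linarith
    rw [hl']
    ring
  rw [monomialCoeff, holCoord, zpow_natCast, mul_pow, hexp]
  push_cast
  ring

/-- Near the south pole, `√x e^{iθ}` is a smooth multiple of the horizontal coordinate, so the
closed form below is visibly smooth there. -/
theorem monomialCoeff_eq_planar {p : S2} (hs : p ≠ south) (hn : p ≠ north) :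
    monomialCoeff N (gRay N ψ s) k p =
      planar p ^ k * ((√(N / (2 * (1 - p.1 2))) ^ k * √(N * (1 - p.1 2) / 2) ^ l
        * Real.exp (s * exponent N ψ k (moment N p)) : ℝ) : ℂ) := by
  have hlt := height_lt_one hn
  have hgt := neg_one_lt_height hs
  have hz : 0 < 1 - p.1 2 := by linarith
  have hp : (‖planar p‖ : ℂ) ≠ 0 := by exact_mod_cast norm_ne_zero_iff.2 (planar_ne_zero hs hn)
  have h1 : √(moment N p) = √(N / (2 * (1 - p.1 2))) * ‖planar p‖ := by
    rw [norm_planar, ← Real.sqrt_mul (by positivity), moment]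
    congr 1
    field_simp
  have h2 : (N : ℝ) - moment N p = N * (1 - p.1 2) / 2 := by rw [moment]; ring
  rw [monomialCoeff_eq hψ hN hkl s hs hn, amplitude, h1, h2, phase_eq, div_pow, mul_pow]
  push_cast
  field_simp

/-- Over the north pole, the change of frame turns `e^{ikθ}` into `e^{-ilθ}`, and `√(N - x) e^{-iθ}`
is a smooth multiple of the conjugate horizontal coordinate. -/
theorem northCoeff_monomialCoeff_eq_planar {p : S2} (hs : p ≠ south) (hn : p ≠ north) :
    northCoeff N (monomialCoeff N (gRay N ψ s) k) p =
      (starRingEnd ℂ (planar p)) ^ l * ((√(N / (2 * (1 + p.1 2))) ^ l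
        * √(N * (1 + p.1 2) / 2) ^ k
        * Real.exp (s * exponent N ψ k (moment N p)) : ℝ) : ℂ) := by
  have hlt := height_lt_one hn
  have hgt := neg_one_lt_height hs
  have hz : 0 < 1 + p.1 2 := by linarith
  have hp : (‖planar p‖ : ℂ) ≠ 0 := by exact_mod_cast norm_ne_zero_iff.2 (planar_ne_zero hs hn)
  have hph := phase_ne_zero hs hn
  have h1 : √(N - moment N p) = √(N / (2 * (1 + p.1 2))) * ‖planar p‖ := by
    rw [norm_planar, ← Real.sqrt_mul (by positivity), moment]
    congr 1
    field_simp
    ring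
  have h2 : moment N p = N * (1 + p.1 2) / 2 := rfl
  have hinv : (phase p)⁻¹ = starRingEnd ℂ (planar p) / ‖planar p‖ := by
    rw [Complex.inv_eq_conj (norm_phase hs hn), phase_eq, map_div₀, Complex.conj_ofReal]
  have hpow : phase p ^ (-(N : ℤ)) * phase p ^ k = (phase p)⁻¹ ^ l := by
    rw [← zpow_natCast (phase p) k, ← zpow_add₀ hph, inv_pow, ← zpow_natCast, ← zpow_neg, ← hkl]
    congr 1
    push_cast
    ring
  rw [northCoeff, if_neg hn, monomialCoeff_eq hψ hN hkl s hs hn, mul_left_comm, hpow, hinv,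
    amplitude, h1, div_pow, mul_pow, ← h2]
  push_cast
  field_simp

end Coefficient

/-! ### Smoothness and holomorphy -/

theorem contDiffOn_derivWithin {N : ℕ} {ψ : ℝ → ℝ} (hN : 0 < N)
    (hψ : ContDiffOn ℝ ∞ ψ (Icc (0 : ℝ) N)) :
    ContDiffOn ℝ ∞ (derivWithin ψ (Icc (0 : ℝ) N)) (Icc (0 : ℝ) N) :=
  hψ.derivWithin (uniqueDiffOn_Icc (by exact_mod_cast hN)) (by simp)

theorem contDiffOn_exponent {N : ℕ} {ψ : ℝ → ℝ} (hN : 0 < N)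
    (hψ : ContDiffOn ℝ ∞ ψ (Icc (0 : ℝ) N)) (n : ℝ) :
    ContDiffOn ℝ ∞ (exponent N ψ n) (Icc (0 : ℝ) N) :=
  ((contDiff_const.sub contDiff_id).contDiffOn.mul (contDiffOn_derivWithin hN hψ)).add hψ

theorem contMDiff_exponent_moment {N : ℕ} {ψ : ℝ → ℝ} (hN : 0 < N)
    (hψ : ContDiffOn ℝ ∞ ψ (Icc (0 : ℝ) N)) (n : ℝ) :
    ContMDiff (𝓡 2) 𝓘(ℝ, ℝ) ∞ fun p : S2 => exponent N ψ n (moment N p) := by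
  rw [← contMDiffOn_univ]
  exact (contDiffOn_exponent hN hψ n).contMDiffOn.comp (contMDiff_moment N).contMDiffOn
    fun p _ => moment_mem N p

section Smooth

variable {N : ℕ} {ψ : ℝ → ℝ} (hψ : ContDiffOn ℝ ∞ ψ (Icc (0 : ℝ) N)) (hN : 0 < N)
include hψ hN

theorem contMDiffOn_planar_formula (k l : ℕ) (s : ℝ) :
    ContMDiffOn (𝓡 2) 𝓘(ℝ, ℂ) ∞ (fun p : S2 =>
      planar p ^ k * ((√(N / (2 * (1 - p.1 2))) ^ k * √(N * (1 - p.1 2) / 2) ^ l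
        * Real.exp (s * exponent N ψ k (moment N p)) : ℝ) : ℂ)) {north}ᶜ := by
  have hN' : (0 : ℝ) < N := by exact_mod_cast hN
  have h : ContDiffOn ℝ ∞ (fun q : (ℂ × ℝ) × ℝ =>
      q.1.1 ^ k * ((√(N / (2 * (1 - q.1.2))) ^ k * √(N * (1 - q.1.2) / 2) ^ l
        * Real.exp (s * q.2) : ℝ) : ℂ)) {q | q.1.2 < 1} := by
    refine (contDiff_fst.fst.pow k).contDiffOn.mul (Complex.ofRealCLM.contDiff.comp_contDiffOn ?_)
    have hz : ContDiff ℝ ∞ fun q : (ℂ × ℝ) × ℝ => 1 - q.1.2 := by fun_prop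
    refine ((ContDiffOn.pow (ContDiffOn.sqrt (contDiffOn_const.div
      (contDiff_const.mul hz).contDiffOn ?_) ?_) k).mul
      (ContDiffOn.pow (ContDiffOn.sqrt ((contDiff_const.mul hz).div_const 2).contDiffOn ?_) l)).mul
      (Real.contDiff_exp.comp (contDiff_const.mul contDiff_snd)).contDiffOn
    all_goals
      intro q hq
      have : 0 < 1 - q.1.2 := by linarith [show q.1.2 < 1 from hq]
      dsimp
      positivity
  exact h.contMDiffOn.comp ((contMDiff_planar.prodMk_space (contMDiff_coord 2)).prodMk_space
    (contMDiff_exponent_moment hN hψ k)).contMDiffOn fun p hp => height_lt_one hp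

theorem contMDiffOn_conj_planar_formula (k l : ℕ) (s : ℝ) :
    ContMDiffOn (𝓡 2) 𝓘(ℝ, ℂ) ∞ (fun p : S2 =>
      (starRingEnd ℂ (planar p)) ^ l * ((√(N / (2 * (1 + p.1 2))) ^ l
        * √(N * (1 + p.1 2) / 2) ^ k
        * Real.exp (s * exponent N ψ k (moment N p)) : ℝ) : ℂ)) {south}ᶜ := by
  have hN' : (0 : ℝ) < N := by exact_mod_cast hN
  have h : ContDiffOn ℝ ∞ (fun q : (ℂ × ℝ) × ℝ =>
      (starRingEnd ℂ q.1.1) ^ l * ((√(N / (2 * (1 + q.1.2))) ^ l * √(N * (1 + q.1.2) / 2) ^ k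
        * Real.exp (s * q.2) : ℝ) : ℂ)) {q | -1 < q.1.2} := by
    refine ((Complex.conjCLE.contDiff.comp contDiff_fst.fst).pow l).contDiffOn.mul
      (Complex.ofRealCLM.contDiff.comp_contDiffOn ?_)
    have hz : ContDiff ℝ ∞ fun q : (ℂ × ℝ) × ℝ => 1 + q.1.2 := by fun_prop
    refine ((ContDiffOn.pow (ContDiffOn.sqrt (contDiffOn_const.div
      (contDiff_const.mul hz).contDiffOn ?_) ?_) l).mul
      (ContDiffOn.pow (ContDiffOn.sqrt ((contDiff_const.mul hz).div_const 2).contDiffOn ?_) k)).mul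
      (Real.contDiff_exp.comp (contDiff_const.mul contDiff_snd)).contDiffOn
    all_goals
      intro q hq
      have : 0 < 1 + q.1.2 := by linarith [show -1 < q.1.2 from hq]
      dsimp
      positivity
  exact h.contMDiffOn.comp ((contMDiff_planar.prodMk_space (contMDiff_coord 2)).prodMk_space
    (contMDiff_exponent_moment hN hψ k)).contMDiffOn fun p hp => neg_one_lt_height hp

variable {k l : ℕ} (hkl : k + l = N) (s : ℝ)
include hkl

theorem sigma_eq {p : S2} (hs : p ≠ south) (hn : p ≠ north) :
    sigma N ψ s k p = (amplitude N ψ k l s (moment N p) : ℂ) * phase p ^ k := by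
  rw [sigma, monomialSection, if_neg hs, if_neg hn, monomialCoeff_eq hψ hN hkl s hs hn]

theorem isSmoothSection_sigma : IsSmoothSection N (sigma N ψ s k) := by
  constructor
  · have hf := contMDiffOn_planar_formula hψ hN k l s
    refine hf.congr fun p (hn : p ≠ north) => ?_
    by_cases hs : p = south
    · subst hs
      rw [sigma, monomialSection, if_pos rfl]
      have hc := (hf.continuousOn.continuousAt (isOpen_compl_singleton.mem_nhds hn)).tendsto
      refine ((hc.mono_left nhdsWithin_le_nhds).congr' ?_).limUnder_eq
      filter_upwards [self_mem_nhdsWithin,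
        mem_nhdsWithin_of_mem_nhds (isOpen_compl_singleton.mem_nhds hn)] with p hs hn
      exact (monomialCoeff_eq_planar hψ hN hkl s hs hn).symm
    · rw [sigma, monomialSection, if_neg hs, if_neg hn]
      exact monomialCoeff_eq_planar hψ hN hkl s hs hn
  · have hf := contMDiffOn_conj_planar_formula hψ hN k l s
    refine hf.congr fun p (hs : p ≠ south) => ?_
    by_cases hn : p = north
    · subst hn
      rw [northCoeff, if_pos rfl, sigma, monomialSection, if_neg hs, if_pos rfl]
      have hc := (hf.continuousOn.continuousAt (isOpen_compl_singleton.mem_nhds hs)).tendsto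
      refine ((hc.mono_left nhdsWithin_le_nhds).congr' ?_).limUnder_eq
      filter_upwards [self_mem_nhdsWithin,
        mem_nhdsWithin_of_mem_nhds (isOpen_compl_singleton.mem_nhds hs)] with p hn hs
      exact (northCoeff_monomialCoeff_eq_planar hψ hN hkl s hs hn).symm
    · rw [← northCoeff_monomialCoeff_eq_planar hψ hN hkl s hs hn, northCoeff, if_neg hn,
        northCoeff, if_neg hn, sigma, monomialSection, if_neg hs, if_neg hn]

theorem sigma_actionAngle {x : ℝ} (hx : x ∈ Ioo (0 : ℝ) N) (θ : ℝ) :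
    sigma N ψ s k (actionAngle N x θ)
      = (amplitude N ψ k l s x : ℂ) * Complex.exp (Complex.I * k * θ) := by
  obtain ⟨hs, hn⟩ := actionAngle_ne_poles θ hx hN
  rw [sigma_eq hψ hN hkl s hs hn, moment_actionAngle θ (Ioo_subset_Icc_self hx) hN,
    phase_actionAngle θ hx hN, ← Complex.exp_nat_mul]
  congr 2
  ring

end Smooth

theorem secondDeriv_eq {N : ℕ} (ψ : ℝ → ℝ) (x : ℝ) :
    secondDeriv N ψ x = derivWithin (derivWithin ψ (Icc (0 : ℝ) N)) (Icc (0 : ℝ) N) x := by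
  rw [secondDeriv, iteratedDerivWithin_succ, iteratedDerivWithin_one]

section Holomorphic

variable {N : ℕ} {ψ : ℝ → ℝ} (hψ : ContDiffOn ℝ ∞ ψ (Icc (0 : ℝ) N)) (hN : 0 < N)
include hψ hN

theorem hasDerivAt_derivWithin {x : ℝ} (hx : x ∈ Ioo (0 : ℝ) N) :
    HasDerivAt (derivWithin ψ (Icc (0 : ℝ) N)) (secondDeriv N ψ x) x := by
  rw [secondDeriv_eq]
  exact (((contDiffOn_derivWithin hN hψ).differentiableOn (by simp) x
    (Ioo_subset_Icc_self hx)).hasDerivWithinAt).hasDerivAt (Icc_mem_nhds hx.1 hx.2)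

theorem hasDerivAt_exponent (n : ℝ) {x : ℝ} (hx : x ∈ Ioo (0 : ℝ) N) :
    HasDerivAt (exponent N ψ n) ((n - x) * secondDeriv N ψ x) x := by
  have hψ' : HasDerivAt ψ (derivWithin ψ (Icc (0 : ℝ) N) x) x :=
    ((hψ.differentiableOn (by simp) x (Ioo_subset_Icc_self hx)).hasDerivWithinAt).hasDerivAt
      (Icc_mem_nhds hx.1 hx.2)
  refine ((((hasDerivAt_id x).const_sub n).mul (hasDerivAt_derivWithin hψ hN hx)).add
    hψ').congr_deriv ?_
  simp only [id]
  ring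

theorem hasDerivAt_deriv_gRay (s : ℝ) {x : ℝ} (hx : x ∈ Ioo (0 : ℝ) N) :
    HasDerivAt (deriv (gRay N ψ s))
      (1 / 2 * (1 / x + 1 / (N - x)) + s * secondDeriv N ψ x) x := by
  have h0 : x ≠ 0 := hx.1.ne'
  have h1 : (N : ℝ) - x ≠ 0 := by have := hx.2; intro h; linarith
  have hs : HasDerivAt (fun x : ℝ => (N : ℝ) - x) (-1) x := by
    simpa using (hasDerivAt_id x).const_sub (N : ℝ)
  have h := (((Real.hasDerivAt_log h0).sub (hs.log h1)).const_mul (1 / 2)).add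
    ((hasDerivAt_derivWithin hψ hN hx).const_mul s)
  refine (h.congr_of_eventuallyEq ?_).congr_deriv ?_
  · filter_upwards [Ioo_mem_nhds hx.1 hx.2] with y hy using (hasDerivAt_gRay hψ s hy).deriv
  · field_simp
    ring

variable {k l : ℕ} (hkl : k + l = N) (s : ℝ)
include hkl

/-- The logarithmic derivative of the amplitude is `(k - x) g_s''(x)`. -/
theorem hasDerivAt_amplitude {x : ℝ} (hx : x ∈ Ioo (0 : ℝ) N) :
    HasDerivAt (amplitude N ψ k l s)
      ((k - x) * (1 / 2 * (1 / x + 1 / (N - x)) + s * secondDeriv N ψ x)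
        * amplitude N ψ k l s x) x := by
  have h0 : x ≠ 0 := hx.1.ne'
  have h1 : (N : ℝ) - x ≠ 0 := by have := hx.2; intro h; linarith
  have hs : HasDerivAt (fun x : ℝ => (N : ℝ) - x) (-1) x := by
    simpa using (hasDerivAt_id x).const_sub (N : ℝ)
  have hsqrt {y : ℝ} (hy : 0 < y) : √y = Real.exp (Real.log y / 2) := by
    rw [Real.exp_half, Real.exp_log hy]
  have hexp : ∀ y ∈ Ioo (0 : ℝ) N, amplitude N ψ k l s y
      = Real.exp (k / 2 * Real.log y + l / 2 * Real.log (N - y) + s * exponent N ψ k y) := by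
    intro y hy
    rw [amplitude, hsqrt hy.1, hsqrt (sub_pos.2 hy.2), ← Real.exp_nat_mul, ← Real.exp_nat_mul,
      ← Real.exp_add, ← Real.exp_add]
    congr 1
    ring
  have h := ((((Real.hasDerivAt_log h0).const_mul (k / 2 : ℝ)).add
    ((hs.log h1).const_mul (l / 2 : ℝ))).add ((hasDerivAt_exponent hψ hN k hx).const_mul s)).exp
  refine (h.congr_of_eventuallyEq ?_).congr_deriv ?_
  · filter_upwards [Ioo_mem_nhds hx.1 hx.2] with y hy using hexp y hy
  · simp only [Pi.add_apply]
    rw [← hexp x hx]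
    have hl : (l : ℝ) = N - k := by rw [← hkl]; push_cast; ring
    rw [hl]
    field_simp
    ring

theorem isHolomorphicSection_sigma (hs : 0 ≤ s)
    (hnonneg : ∀ x ∈ Icc (0 : ℝ) N, 0 ≤ secondDeriv N ψ x) :
    IsHolomorphicSection N (gRay N ψ s) (sigma N ψ s k) := by
  intro x hx θ
  have h1 : 0 < (N : ℝ) - x := sub_pos.2 hx.2
  have hpos : 0 < 1 / 2 * (1 / x + 1 / (N - x)) + s * secondDeriv N ψ x := by
    have h2 := mul_nonneg hs (hnonneg x (Ioo_subset_Icc_self hx))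
    have h0 := hx.1
    positivity
  have hdx : HasDerivAt (fun x' : ℝ => sigma N ψ s k (actionAngle N x' θ))
      ((((k - x) * (1 / 2 * (1 / x + 1 / (N - x)) + s * secondDeriv N ψ x)
        * amplitude N ψ k l s x : ℝ) : ℂ) * Complex.exp (Complex.I * k * θ)) x := by
    refine ((hasDerivAt_amplitude hψ hN hkl s hx).ofReal_comp.mul_const _).congr_of_eventuallyEq ?_
    filter_upwards [Ioo_mem_nhds hx.1 hx.2] with y hy
    exact sigma_actionAngle hψ hN hkl s hy θ
  have hdθ : HasDerivAt (fun θ' : ℝ => sigma N ψ s k (actionAngle N x θ'))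
      ((amplitude N ψ k l s x : ℂ) * (Complex.exp (Complex.I * k * θ) * (Complex.I * k))) θ := by
    simp_rw [sigma_actionAngle hψ hN hkl s hx]
    refine HasDerivAt.const_mul _ (HasDerivAt.cexp ?_)
    simpa using (Complex.ofRealCLM.hasDerivAt (x := θ)).const_mul (Complex.I * k)
  rw [hdx.deriv, hdθ.deriv, (hasDerivAt_deriv_gRay hψ hN s hx).deriv,
    sigma_actionAngle hψ hN hkl s hx]
  set G := 1 / 2 * (1 / x + 1 / (N - x)) + s * secondDeriv N ψ x
  have hG : (G : ℂ) ≠ 0 := by exact_mod_cast hpos.ne'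
  generalize Complex.exp (Complex.I * k * θ) = e
  push_cast
  field_simp
  linear_combination (amplitude N ψ k l s x : ℂ) * (k - x) * e * Complex.I_sq

end Holomorphic

/-! ### The maximum of the exponent -/

theorem lt_of_hasDerivAt_nonneg {f f' : ℝ → ℝ} {a b : ℝ} (hc : ContinuousOn f (Icc a b))
    (hd : ∀ x ∈ Ioo a b, HasDerivAt f (f' x) x) (h0 : ∀ x ∈ Ioo a b, 0 ≤ f' x)
    (hne : ∃ x ∈ Ioo a b, f' x ≠ 0) : f a < f b := by
  obtain ⟨t, ht, htne⟩ := hne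
  have hab : a ≤ b := (ht.1.trans ht.2).le
  have hmono : MonotoneOn f (Icc a b) := by
    refine monotoneOn_of_deriv_nonneg (convex_Icc a b) hc ?_ ?_ <;> rw [interior_Icc]
    · exact fun x hx => (hd x hx).differentiableAt.differentiableWithinAt
    · intro x hx
      rw [(hd x hx).deriv]
      exact h0 x hx
  refine lt_of_le_of_ne (hmono (left_mem_Icc.2 hab) (right_mem_Icc.2 hab) hab) fun h => htne ?_
  -- equal values at the endpoints make `f` constant on `[a, b]`
  have hconst : f =ᶠ[𝓝 t] fun _ => f a := by
    filter_upwards [Ioo_mem_nhds ht.1 ht.2] with x hx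
    have hx' := Ioo_subset_Icc_self hx
    exact le_antisymm ((hmono hx' (right_mem_Icc.2 hab) hx'.2).trans h.ge)
      (hmono (left_mem_Icc.2 hab) hx' hx'.1)
  exact (hd t ht).unique ((hasDerivAt_const t (f a)).congr_of_eventuallyEq hconst)

section Exponent

variable {N : ℕ} {m α : ℝ} {ψ : ℝ → ℝ}

theorem IsBumpPotential.nat_pos (h : IsBumpPotential N m α ψ) : 0 < N := by
  have h1 := h.radius_pos
  have h2 := h.left_mem
  have h3 := h.right_mem
  exact_mod_cast (show (0 : ℝ) < N by linarith)

theorem IsBumpPotential.exists_secondDeriv_ne_zero (h : IsBumpPotential N m α ψ) {a b : ℝ}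
    (ha : a < m + α) (hb : m - α < b) (hab : a < b) :
    ∃ t ∈ Ioo a b, secondDeriv N ψ t ≠ 0 := by
  have hr := h.radius_pos
  obtain ⟨t, ht1, ht2⟩ : ∃ t, a ⊔ (m - α) < t ∧ t < b ⊓ (m + α) :=
    exists_between (max_lt (lt_min hab ha) (lt_min hb (by linarith)))
  have ht : t ∈ closure {x ∈ Icc (0 : ℝ) N | secondDeriv N ψ x ≠ 0} := by
    rw [h.supp]
    exact ⟨(le_max_right _ _).trans ht1.le, ht2.le.trans (min_le_right _ _)⟩
  obtain ⟨u, hu, -, hne⟩ := mem_closure_iff.1 ht (Ioo a b) isOpen_Ioo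
    ⟨(le_max_left _ _).trans_lt ht1, ht2.trans_le (min_le_left _ _)⟩
  exact ⟨u, hu, hne⟩

theorem IsBumpPotential.secondDeriv_eq_zero (h : IsBumpPotential N m α ψ) {x : ℝ}
    (hx : x ∈ Icc (0 : ℝ) N) (hS : x ∉ Icc (m - α) (m + α)) : secondDeriv N ψ x = 0 := by
  by_contra hne
  exact hS (h.supp ▸ subset_closure ⟨hx, hne⟩)

theorem IsBumpPotential.exponent_lt_of_le_left (h : IsBumpPotential N m α ψ) {n a b : ℝ}
    (hna : n ≤ a) (h0 : 0 ≤ a) (hab : a < b) (hb : b ≤ N) (ha' : a < m + α) (hb' : m - α < b) :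
    exponent N ψ n b < exponent N ψ n a := by
  have hsub : Icc a b ⊆ Icc 0 N := Icc_subset_Icc h0 hb
  refine neg_lt_neg_iff.1 (lt_of_hasDerivAt_nonneg (f := fun x => -exponent N ψ n x)
    (f' := fun x => -((n - x) * secondDeriv N ψ x))
    ((contDiffOn_exponent h.nat_pos h.smooth n).continuousOn.mono hsub).neg
    (fun x hx => (hasDerivAt_exponent h.smooth h.nat_pos n (Ioo_subset_Ioo h0 hb hx)).neg)
    (fun x hx => ?_) ?_)
  · have := h.nonneg x (hsub (Ioo_subset_Icc_self hx))
    nlinarith [hx.1]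
  · obtain ⟨t, ht, hne⟩ := h.exists_secondDeriv_ne_zero ha' hb' hab
    exact ⟨t, ht, neg_ne_zero.2 (mul_ne_zero (by linarith [ht.1] : n - t < 0).ne hne)⟩

theorem IsBumpPotential.exponent_lt_of_right_le (h : IsBumpPotential N m α ψ) {n a b : ℝ}
    (hbn : b ≤ n) (h0 : 0 ≤ a) (hab : a < b) (hb : b ≤ N) (ha' : a < m + α) (hb' : m - α < b) :
    exponent N ψ n a < exponent N ψ n b := by
  have hsub : Icc a b ⊆ Icc 0 N := Icc_subset_Icc h0 hb
  refine lt_of_hasDerivAt_nonneg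
    ((contDiffOn_exponent h.nat_pos h.smooth n).continuousOn.mono hsub)
    (fun x hx => hasDerivAt_exponent h.smooth h.nat_pos n (Ioo_subset_Ioo h0 hb hx))
    (fun x hx => ?_) ?_
  · exact mul_nonneg (by linarith [hx.2]) (h.nonneg x (hsub (Ioo_subset_Icc_self hx)))
  · obtain ⟨t, ht, hne⟩ := h.exists_secondDeriv_ne_zero ha' hb' hab
    exact ⟨t, ht, mul_ne_zero (by linarith [ht.2] : 0 < n - t).ne' hne⟩

theorem IsBumpPotential.exponent_eq (h : IsBumpPotential N m α ψ) (n : ℝ) {a b : ℝ}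
    (h0 : 0 ≤ a) (hab : a ≤ b) (hb : b ≤ N) (hS : b ≤ m - α ∨ m + α ≤ a) :
    exponent N ψ n a = exponent N ψ n b := by
  rcases hab.eq_or_lt with rfl | hab
  · rfl
  obtain ⟨c, hc, hslope⟩ := exists_hasDerivAt_eq_slope (exponent N ψ n)
    (fun x => (n - x) * secondDeriv N ψ x) hab
    ((contDiffOn_exponent h.nat_pos h.smooth n).continuousOn.mono (Icc_subset_Icc h0 hb))
    (fun x hx => hasDerivAt_exponent h.smooth h.nat_pos n (Ioo_subset_Ioo h0 hb hx))
  have hzero : secondDeriv N ψ c = 0 :=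
    h.secondDeriv_eq_zero ⟨h0.trans hc.1.le, hc.2.le.trans hb⟩ fun hcS => by
      rcases hS with hS | hS
      · linarith [hcS.1, hc.2]
      · linarith [hcS.2, hc.1]
  have hba : b - a ≠ 0 := (sub_pos.2 hab).ne'
  rw [hzero, mul_zero, eq_comm, div_eq_zero_iff, or_iff_left hba] at hslope
  linarith

theorem IsBumpPotential.exponent_lt_of_mem_Ioo (h : IsBumpPotential N m α ψ) {n x : ℝ}
    (hn : n ∈ Ioo (m - α) (m + α)) (hx : x ∈ Icc (0 : ℝ) N) (hne : x ≠ n) :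
    exponent N ψ n x < exponent N ψ n n := by
  have h1 := h.left_mem
  have h2 := h.right_mem
  rcases lt_or_gt_of_ne hne with hlt | hgt
  · exact h.exponent_lt_of_right_le le_rfl hx.1 hlt (by linarith [hn.2]) (hlt.trans hn.2) hn.1
  · exact h.exponent_lt_of_le_left le_rfl (by linarith [hn.1]) hgt hx.2 hn.2 (hn.1.trans hgt)

/-- For `n` in one of the two intervals on which `ψ''` vanishes, that interval is exactly the set
of maximum points of the exponent. -/
theorem IsBumpPotential.exponent_eq_and_lt (h : IsBumpPotential N m α ψ) {n : ℝ} {Q : Set ℝ}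
    (hQ : Q = Icc 0 (m - α) ∨ Q = Icc (m + α) N) (hn : n ∈ Q) {x : ℝ}
    (hx : x ∈ Icc (0 : ℝ) N) :
    (x ∈ Q → exponent N ψ n x = exponent N ψ n n) ∧
      (x ∉ Q → exponent N ψ n x < exponent N ψ n n) := by
  have h0 := h.radius_pos
  have h1 := h.left_mem
  have h2 := h.right_mem
  rcases hQ with rfl | rfl
  · have hc {y : ℝ} (hy : y ∈ Icc 0 (m - α)) : exponent N ψ n 0 = exponent N ψ n y :=
      h.exponent_eq n le_rfl hy.1 (by linarith [hy.2]) (Or.inl hy.2)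
    refine ⟨fun hxQ => (hc hxQ).symm.trans (hc hn), fun hxQ => ?_⟩
    have hlt : m - α < x := not_le.1 fun hle => hxQ ⟨hx.1, hle⟩
    rw [← hc hn, hc (right_mem_Icc.2 h1.le)]
    exact h.exponent_lt_of_le_left hn.2 h1.le hlt hx.2 (by linarith) hlt
  · have hc {y : ℝ} (hy : y ∈ Icc (m + α) N) : exponent N ψ n y = exponent N ψ n N :=
      h.exponent_eq n (by linarith [hy.1]) hy.2 le_rfl (Or.inr hy.1)
    refine ⟨fun hxQ => (hc hxQ).trans (hc hn).symm, fun hxQ => ?_⟩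
    have hlt : x < m + α := not_le.1 fun hle => hxQ ⟨hle, hx.2⟩
    rw [hc hn, ← hc (left_mem_Icc.2 h2.le)]
    exact h.exponent_lt_of_right_le hn.1 hx.1 hlt h2.le hlt (by linarith)

end Exponent

/-! ### Exponential concentration of integrals -/

/-- Laplace's principle: the probability densities proportional to `exp (r f)` concentrate at the
unique maximum point of `f` as `r → ∞`. -/
theorem tendsto_setIntegral_exp_smul_of_unique_maximum {X E : Type*} [TopologicalSpace X]
    [TopologicalSpace.MetrizableSpace X] [MeasurableSpace X] [BorelSpace X] [NormedAddCommGroup E] [NormedSpace ℝ E]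
    [CompleteSpace E]
    {μ : Measure X} [IsLocallyFiniteMeasure μ] {K : Set X} (hK : IsCompact K) {x₀ : X}
    (hμ : ∀ u, IsOpen u → x₀ ∈ u → 0 < μ (u ∩ K)) {f : X → ℝ} (hf : ContinuousOn f K)
    (hmax : ∀ y ∈ K, y ≠ x₀ → f y < f x₀) (hx₀ : x₀ ∈ K) {g : X → E}
    (hg : IntegrableOn g K μ) (hgc : ContinuousWithinAt g K x₀) :
    Tendsto (fun r : ℝ => (∫ x in K, Real.exp (r * f x) ∂μ)⁻¹ •
      ∫ x in K, Real.exp (r * f x) • g x ∂μ) atTop (𝓝 (g x₀)) := by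
  have hfin {v : Set X} : μ (v ∩ K) ≠ ⊤ :=
    ((measure_mono inter_subset_right).trans_lt hK.measure_lt_top).ne
  have hint (r : ℝ) : IntegrableOn (fun x => Real.exp (r * f x)) K μ :=
    ((continuousOn_const.mul hf).rexp).integrableOn_compact hK
  have hpos {v : Set X} (hv : IsOpen v) (hxv : x₀ ∈ v) : 0 < μ.real (v ∩ K) :=
    ENNReal.toReal_pos (hμ v hv hxv).ne' hfin
  have hlower {v : Set X} (hv : IsOpen v) {t r : ℝ} (hr : 0 ≤ r) (ht : ∀ x ∈ v ∩ K, t ≤ f x) :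
      μ.real (v ∩ K) * Real.exp (r * t) ≤ ∫ x in K, Real.exp (r * f x) ∂μ :=
    calc
      _ = ∫ _ in v ∩ K, Real.exp (r * t) ∂μ := by simp
      _ ≤ ∫ x in v ∩ K, Real.exp (r * f x) ∂μ :=
        setIntegral_mono_on (integrableOn_const hfin) ((hint r).mono_set inter_subset_right)
          (hv.measurableSet.inter hK.measurableSet) fun x hx => by
            gcongr
            exact ht x hx
      _ ≤ _ := setIntegral_mono_set (hint r) (ae_of_all _ fun x => (Real.exp_pos _).le)
          (Eventually.of_forall inter_subset_right)
  have htotal (r : ℝ) : 0 < ∫ x in K, Real.exp (r * f x) ∂μ := by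
    have hKpos : 0 < μ K := by simpa using hμ univ isOpen_univ (mem_univ _)
    have : NeZero (μ.restrict K) := ⟨by simpa using hKpos.ne'⟩
    exact integral_exp_pos (hint r)
  have hunif : ∀ u : Set X, IsOpen u → x₀ ∈ u → TendstoUniformlyOn
      (fun r x => (∫ y in K, Real.exp (r * f y) ∂μ)⁻¹ * Real.exp (r * f x)) 0 atTop (K \ u) := by
    intro u hu hxu
    obtain ⟨t, ht, htu⟩ : ∃ t, t < f x₀ ∧ ∀ x ∈ K \ u, f x ≤ t := by
      rcases eq_empty_or_nonempty (K \ u) with he | hne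
      · exact ⟨f x₀ - 1, by linarith, by simp [he]⟩
      obtain ⟨x, hx, hxm⟩ := (hK.diff hu).exists_isMaxOn hne (hf.mono sdiff_subset)
      exact ⟨f x, hmax x hx.1 fun h => hx.2 (h ▸ hxu), hxm⟩
    -- off `u` the density is at most `exp (r t)` divided by `exp (r t')` times the mass of a
    -- neighbourhood of `x₀` on which `f > t'`, and `t < t'`
    obtain ⟨t', htt', ht'⟩ := exists_between ht
    obtain ⟨v, hv, hxv, hvt⟩ := continuousOn_iff.1 hf x₀ hx₀ (Ioi t') isOpen_Ioi ht'
    have hlim : Tendsto (fun r : ℝ => (μ.real (v ∩ K))⁻¹ * Real.exp (r * (t - t'))) atTop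
        (𝓝 ((μ.real (v ∩ K))⁻¹ * 0)) :=
      (Real.tendsto_exp_atBot.comp
        (tendsto_id.atTop_mul_const_of_neg (by linarith))).const_mul _
    rw [mul_zero] at hlim
    refine Metric.tendstoUniformlyOn_iff.2 fun ε hε => ?_
    filter_upwards [(tendsto_order.1 hlim).2 ε hε, eventually_ge_atTop 0] with r hr hr0 x hx
    rw [Pi.zero_apply, dist_zero_left, Real.norm_of_nonneg
      (mul_nonneg (inv_nonneg.2 (htotal r).le) (Real.exp_pos _).le)]
    refine lt_of_le_of_lt ?_ hr
    have hp := hpos hv hxv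
    calc
      _ ≤ (μ.real (v ∩ K) * Real.exp (r * t'))⁻¹ * Real.exp (r * t) := by
        gcongr
        · exact hlower hv hr0 fun y hy => (hvt hy).le
        · exact htu x hx
      _ = _ := by rw [mul_inv, mul_sub, Real.exp_sub]; ring
  have := tendsto_setIntegral_peak_smul_of_integrableOn_of_tendsto hK.measurableSet
    hK.measurableSet Subset.rfl self_mem_nhdsWithin hK.measure_lt_top.ne
    (Eventually.of_forall fun r x _ =>
      mul_nonneg (inv_nonneg.2 (htotal r).le) (Real.exp_pos _).le) hunif
    (tendsto_const_nhds.congr fun r => by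
      rw [integral_const_mul, inv_mul_cancel₀ (htotal r).ne'])
    (Eventually.of_forall fun r => ((hint r).const_mul _).aestronglyMeasurable) hg hgc
  refine this.congr fun r => ?_
  simp_rw [mul_smul]
  exact integral_smul _ _

/-- If `f ≤ M`, then the weights `exp (r (f - M))` converge to the indicator of the set where
`f = M`. -/
theorem tendsto_integral_exp_smul_of_le {X E : Type*} [MeasurableSpace X]
    [NormedAddCommGroup E] [NormedSpace ℝ E] {μ : Measure X} {f : X → ℝ} {M : ℝ}
    (hf : AEStronglyMeasurable f μ) {Q : Set X} (hM : ∀ᵐ x ∂μ, x ∈ Q → f x = M)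
    (hlt : ∀ᵐ x ∂μ, x ∉ Q → f x < M) {g : X → E} (hg : Integrable g μ) :
    Tendsto (fun r : ℝ => ∫ x, Real.exp (r * (f x - M)) • g x ∂μ) atTop
      (𝓝 (∫ x, Q.indicator g x ∂μ)) := by
  refine tendsto_integral_filter_of_dominated_convergence (fun x => ‖g x‖)
    (Eventually.of_forall fun r => ?_) ?_ hg.norm ?_
  · exact (Real.continuous_exp.comp_aestronglyMeasurable
      ((hf.sub aestronglyMeasurable_const).const_mul r)).smul hg.aestronglyMeasurable
  · filter_upwards [eventually_ge_atTop 0] with r hr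
    filter_upwards [hM, hlt] with x hx hx'
    have hle : f x ≤ M := by
      by_cases hxQ : x ∈ Q
      · exact (hx hxQ).le
      · exact (hx' hxQ).le
    rw [norm_smul, Real.norm_of_nonneg (Real.exp_pos _).le]
    refine mul_le_of_le_one_left (norm_nonneg _) (Real.exp_le_one_iff.2 ?_)
    exact mul_nonpos_of_nonneg_of_nonpos hr (sub_nonpos.2 hle)
  · filter_upwards [hM, hlt] with x hx hx'
    by_cases hxQ : x ∈ Q
    · simp [hxQ, hx hxQ]
    · rw [indicator_of_notMem hxQ, ← zero_smul ℝ (g x)]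
      exact (Real.tendsto_exp_atBot.comp
        (tendsto_id.atTop_mul_const_of_neg (sub_neg.2 (hx' hxQ)))).smul_const _

/-! ### Integrals in action-angle coordinates -/

theorem IsSmoothSection.measurable {k : ℤ} {u : S2 → ℂ} (hu : IsSmoothSection k u) :
    Measurable u :=
  measurable_of_continuousOn_compl_singleton north hu.1.continuousOn

/-- The pointwise norm is independent of the unitary frame, hence continuous on the whole sphere. -/
theorem IsSmoothSection.exists_bound {k : ℤ} {u : S2 → ℂ} (hu : IsSmoothSection k u) :
    ∃ C, ∀ p, ‖u p‖ ≤ C := by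
  have hc : Continuous fun p => ‖u p‖ := by
    rw [continuous_iff_continuousAt]
    intro p
    by_cases hp : p = north
    · subst hp
      have hmem : ({south}ᶜ : Set S2) ∈ 𝓝 north :=
        isOpen_compl_singleton.mem_nhds south_ne_north.symm
      refine (hu.2.continuousOn.continuousAt hmem).norm.congr ?_
      filter_upwards [hmem] with q (hq : q ≠ south)
      by_cases hqn : q = north
      · rw [northCoeff, if_pos hqn]
      · rw [northCoeff, if_neg hqn, norm_mul, norm_zpow, norm_phase hq hqn, one_zpow, one_mul]
    · exact (hu.1.continuousOn.continuousAt (isOpen_compl_singleton.mem_nhds hp)).norm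
  obtain ⟨C, hC⟩ := isCompact_univ.exists_bound_of_continuousOn hc.continuousOn
  exact ⟨C, fun p => by simpa using hC p (mem_univ p)⟩

/-- The domain of the action-angle coordinates `(x, θ)` of the sphere. -/
def coordRect (N : ℕ) : Set (ℝ × ℝ) := Ioo (0 : ℝ) N ×ˢ Ioo (0 : ℝ) (2 * Real.pi)

theorem isOpen_coordRect (N : ℕ) : IsOpen (coordRect N) := isOpen_Ioo.prod isOpen_Ioo

theorem volume_coordRect_lt_top (N : ℕ) : volume (coordRect N) < ⊤ := by
  rw [coordRect, Measure.volume_eq_prod, Measure.prod_prod]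
  exact ENNReal.mul_lt_top measure_Ioo_lt_top measure_Ioo_lt_top

theorem integral_liouville {E : Type*} [NormedAddCommGroup E] [NormedSpace ℝ E] {N : ℕ}
    {f : S2 → E} (hf : StronglyMeasurable f) :
    ∫ p, f p ∂(liouville N) = ∫ q in coordRect N, f (actionAngle N q.1 q.2) :=
  integral_map (continuous_actionAngle N).measurable.aemeasurable hf.aestronglyMeasurable

/-- The integral over the sphere of the product of a function `f` of the moment map and a function
`w` of the action-angle coordinates. -/
noncomputable def coordIntegral (N : ℕ) (f : ℝ → ℝ) (w : ℝ × ℝ → ℂ) : ℂ :=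
  ∫ q in coordRect N, (f q.1 : ℂ) * w q

/-- The pairing of a section of `L⁻¹` with the unitary section `e^{ikθ}`, in action-angle
coordinates. -/
noncomputable def pairing (N k : ℕ) {U : Set S2} (τ : TestSection N U) (q : ℝ × ℝ) : ℂ :=
  Complex.exp (Complex.I * k * q.2) * τ.toFun (actionAngle N q.1 q.2)

theorem measurable_pairing (N k : ℕ) {U : Set S2} (τ : TestSection N U) :
    Measurable (pairing N k τ) := by
  refine Measurable.mul ?_ (τ.smooth.measurable.comp (continuous_actionAngle N).measurable)
  exact Continuous.measurable (by fun_prop)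

theorem norm_exp_I_mul (k : ℕ) (θ : ℝ) : ‖Complex.exp (Complex.I * k * θ)‖ = 1 := by
  have : Complex.I * k * θ = ((k * θ : ℝ) : ℂ) * Complex.I := by push_cast; ring
  rw [this, Complex.norm_exp_ofReal_mul_I]

theorem exists_bound_pairing (N k : ℕ) {U : Set S2} (τ : TestSection N U) :
    ∃ C, ∀ q, ‖pairing N k τ q‖ ≤ C := by
  obtain ⟨C, hC⟩ := τ.smooth.exists_bound
  refine ⟨C, fun q => ?_⟩
  rw [pairing, norm_mul, norm_exp_I_mul, one_mul]
  exact hC _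

/-- The distributional section of an `L¹`-normalized section of the form `f(x) e^{ikθ}`. -/
theorem iota_div_l1Norm {N k : ℕ} {U : Set S2} (τ : TestSection N U) {v : S2 → ℂ}
    (hv : Measurable v) {f : ℝ → ℝ} (hf : ∀ x, 0 ≤ f x)
    (hvf : ∀ x ∈ Ioo (0 : ℝ) N, ∀ θ : ℝ,
      v (actionAngle N x θ) = (f x : ℂ) * Complex.exp (Complex.I * k * θ)) :
    iota N U (fun p => v p / (l1Norm N univ v : ℂ)) τ =
      coordIntegral N f (pairing N k τ) / coordIntegral N f 1 := by
  have hnum : iota N U (fun p => v p / (l1Norm N univ v : ℂ)) τ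
      = coordIntegral N f (pairing N k τ) / (l1Norm N univ v : ℂ) := by
    rw [iota, setIntegral_eq_integral_of_forall_compl_eq_zero fun p hp => by
        rw [image_eq_zero_of_notMem_tsupport fun h => hp (τ.supp h), mul_zero],
      integral_liouville (f := fun p => v p / (l1Norm N univ v : ℂ) * τ.toFun p)
        ((hv.div_const _).mul τ.smooth.measurable).stronglyMeasurable,
      coordIntegral, ← integral_div]
    refine setIntegral_congr_fun (isOpen_coordRect N).measurableSet fun q hq => ?_
    simp only [hvf q.1 hq.1 q.2, pairing]
    ring
  have hden : (l1Norm N univ v : ℂ) = coordIntegral N f 1 := by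
    rw [l1Norm, setIntegral_univ, integral_liouville hv.norm.stronglyMeasurable, coordIntegral,
      ← integral_complex_ofReal]
    refine setIntegral_congr_fun (isOpen_coordRect N).measurableSet fun q hq => ?_
    simp only [hvf q.1 hq.1 q.2, norm_mul, norm_exp_I_mul, mul_one, Complex.norm_real,
      Real.norm_of_nonneg (hf _), Pi.one_apply]
  rw [hnum, hden]

/-! ### Limits of the normalized sections -/

theorem amplitude_nonneg (N : ℕ) (ψ : ℝ → ℝ) (k l : ℕ) (s x : ℝ) :
    0 ≤ amplitude N ψ k l s x := by
  unfold amplitude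
  positivity

theorem amplitude_eq (N : ℕ) (ψ : ℝ → ℝ) (k l : ℕ) (s x : ℝ) :
    amplitude N ψ k l s x = Real.exp (s * exponent N ψ k x) * amplitude N ψ k l 0 x := by
  simp only [amplitude, zero_mul, Real.exp_zero, mul_one]
  ring

theorem amplitude_zero_pos {N : ℕ} (ψ : ℝ → ℝ) (k l : ℕ) {x : ℝ} (hx : x ∈ Ioo (0 : ℝ) N) :
    0 < amplitude N ψ k l 0 x := by
  have h1 := Real.sqrt_pos.2 hx.1
  have h2 := Real.sqrt_pos.2 (sub_pos.2 hx.2)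
  unfold amplitude
  positivity

theorem continuous_amplitude_zero (N : ℕ) (ψ : ℝ → ℝ) (k l : ℕ) :
    Continuous (amplitude N ψ k l 0) := by
  have : amplitude N ψ k l 0 = fun x => √x ^ k * √(N - x) ^ l := by
    ext x
    simp [amplitude]
  rw [this]
  fun_prop

section Limits

variable {N : ℕ} {m α : ℝ} {ψ : ℝ → ℝ} {k l : ℕ}

theorem integrableOn_amplitude_mul (N : ℕ) (ψ : ℝ → ℝ) (k l : ℕ) {w : ℝ × ℝ → ℂ}
    (hw : Measurable w) {C : ℝ} (hC : ∀ q, ‖w q‖ ≤ C) :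
    IntegrableOn (fun q => (amplitude N ψ k l 0 q.1 : ℂ) * w q) (coordRect N) := by
  obtain ⟨B, hB⟩ := (isCompact_Icc (a := (0 : ℝ)) (b := N)).exists_bound_of_continuousOn
    (continuous_amplitude_zero N ψ k l).continuousOn
  refine Measure.integrableOn_of_bounded (M := B * C) (volume_coordRect_lt_top N).ne ?_ ?_
  · exact ((Complex.measurable_ofReal.comp
      ((continuous_amplitude_zero N ψ k l).measurable.comp measurable_fst)).mul
        hw).aestronglyMeasurable
  · filter_upwards [ae_restrict_mem (isOpen_coordRect N).measurableSet] with q hq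
    rw [norm_mul, Complex.norm_real]
    have hb := hB q.1 (Ioo_subset_Icc_self hq.1)
    exact mul_le_mul hb (hC q) (norm_nonneg _) ((norm_nonneg _).trans hb)

theorem aestronglyMeasurable_exponent_fst (h : IsBumpPotential N m α ψ) (n : ℝ) :
    AEStronglyMeasurable (fun q : ℝ × ℝ => exponent N ψ n q.1)
      (volume.restrict (coordRect N)) := by
  refine ContinuousOn.aestronglyMeasurable ?_ (isOpen_coordRect N).measurableSet
  exact (contDiffOn_exponent h.nat_pos h.smooth n).continuousOn.comp continuousOn_fst
    fun q hq => Ioo_subset_Icc_self hq.1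

/-- Where the exponent attains its maximum on a whole interval `Q`, rescaled integrals against the
monomial sections converge to integrals over `Q`. -/
theorem tendsto_coordIntegral_of_mem (h : IsBumpPotential N m α ψ) {Q : Set ℝ}
    (hQ : Q = Icc 0 (m - α) ∨ Q = Icc (m + α) N) (hk : (k : ℝ) ∈ Q) {w : ℝ × ℝ → ℂ}
    (hw : Measurable w) {C : ℝ} (hC : ∀ q, ‖w q‖ ≤ C) :
    Tendsto (fun s : ℝ => (Real.exp (-(s * exponent N ψ k k)) : ℂ) *
        coordIntegral N (amplitude N ψ k l s) w) atTop
      (𝓝 (coordIntegral N (Q.indicator (amplitude N ψ k l 0)) w)) := by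
  have hmem := ae_restrict_mem (μ := volume) (isOpen_coordRect N).measurableSet
  have hlim := tendsto_integral_exp_smul_of_le (aestronglyMeasurable_exponent_fst h k)
    (M := exponent N ψ k k) (Q := Prod.fst ⁻¹' Q)
    (hmem.mono fun q hq => (h.exponent_eq_and_lt hQ hk (Ioo_subset_Icc_self hq.1)).1)
    (hmem.mono fun q hq => (h.exponent_eq_and_lt hQ hk (Ioo_subset_Icc_self hq.1)).2)
    (integrableOn_amplitude_mul N ψ k l hw hC)
  have hlim_eq : coordIntegral N (Q.indicator (amplitude N ψ k l 0)) w
      = ∫ q in coordRect N, (Prod.fst ⁻¹' Q).indicator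
        (fun q => (amplitude N ψ k l 0 q.1 : ℂ) * w q) q := by
    rw [coordIntegral]
    congr 1
    ext q
    by_cases hq : q.1 ∈ Q <;> simp [hq]
  rw [hlim_eq]
  refine hlim.congr fun s => ?_
  rw [coordIntegral, ← integral_const_mul]
  congr 1
  ext q
  rw [amplitude_eq N ψ k l s, mul_sub, Real.exp_sub, Real.exp_neg, Complex.real_smul]
  push_cast
  ring

theorem coordIntegral_indicator_ne_zero (h : IsBumpPotential N m α ψ) {Q : Set ℝ}
    (hQ : Q = Icc 0 (m - α) ∨ Q = Icc (m + α) N) :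
    coordIntegral N (Q.indicator (amplitude N ψ k l 0)) 1 ≠ 0 := by
  have h0 := h.radius_pos
  have h1 := h.left_mem
  have h2 := h.right_mem
  have hQm : MeasurableSet Q := by rcases hQ with rfl | rfl <;> exact measurableSet_Icc
  obtain ⟨a, b, hab, hsubQ, hsub⟩ : ∃ a b : ℝ, a < b ∧ Ioo a b ⊆ Q ∧ Ioo a b ⊆ Ioo 0 (N : ℝ) := by
    rcases hQ with rfl | rfl
    · exact ⟨0, m - α, h1, Ioo_subset_Icc_self, Ioo_subset_Ioo_right (by linarith)⟩
    · exact ⟨m + α, N, h2, Ioo_subset_Icc_self, Ioo_subset_Ioo_left (by linarith)⟩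
  set F : ℝ × ℝ → ℝ := (Prod.fst ⁻¹' Q).indicator fun q => amplitude N ψ k l 0 q.1 with hF
  have heq : coordIntegral N (Q.indicator (amplitude N ψ k l 0)) 1
      = ((∫ q in coordRect N, F q : ℝ) : ℂ) := by
    rw [coordIntegral, ← integral_complex_ofReal]
    congr 1
    ext q
    by_cases hq : q.1 ∈ Q <;> simp [hF, hq]
  have hint : IntegrableOn F (coordRect N) := by
    have := (integrableOn_amplitude_mul N ψ k l (w := 1) measurable_const (C := 1)
      fun q => by simp).re
    simp only [Pi.one_apply, mul_one] at this
    exact Integrable.indicator this (measurable_fst hQm)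
  have hnn : ∀ q, 0 ≤ F q := fun q =>
    indicator_nonneg (fun q _ => amplitude_nonneg N ψ k l 0 q.1) q
  rw [heq]
  refine Complex.ofReal_ne_zero.2 (ne_of_gt ?_)
  rw [setIntegral_pos_iff_support_of_nonneg_ae (ae_of_all _ hnn) hint]
  refine lt_of_lt_of_le ((isOpen_Ioo.prod isOpen_Ioo).measure_pos volume
    ((nonempty_Ioo.2 hab).prod (nonempty_Ioo.2 Real.two_pi_pos))) (measure_mono ?_)
  rintro q ⟨hq1, hq2⟩
  refine ⟨?_, hsub hq1, hq2⟩
  rw [Function.mem_support, hF, indicator_of_mem (show q ∈ Prod.fst ⁻¹' Q from hsubQ hq1)]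
  exact (amplitude_zero_pos ψ k l (hsub hq1)).ne'

/-- Where the exponent has a strict maximum at `k`, rescaled integrals against the monomial
sections converge to integrals over the circle of moment map value `k`. -/
theorem tendsto_coordIntegral_of_mem_Ioo (h : IsBumpPotential N m α ψ)
    (hk : (k : ℝ) ∈ Ioo (m - α) (m + α)) {w : ℝ × ℝ → ℂ}
    (hw : Measurable w) {C : ℝ} (hC : ∀ q, ‖w q‖ ≤ C)
    (hcont : ∀ θ, ContinuousAt (fun x => w (x, θ)) k) :
    Tendsto (fun s : ℝ => ((∫ x in Icc (0 : ℝ) N, Real.exp (s * exponent N ψ k x))⁻¹ : ℝ) •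
        coordIntegral N (amplitude N ψ k l s) w) atTop
      (𝓝 ((amplitude N ψ k l 0 k : ℂ) * ∫ θ in Ioo (0 : ℝ) (2 * Real.pi), w (k, θ))) := by
  have h1 := h.left_mem
  have h2 := h.right_mem
  have hk' : (k : ℝ) ∈ Ioo (0 : ℝ) N := ⟨by linarith [hk.1], by linarith [hk.2]⟩
  set T : ℝ → ℂ := fun x => ∫ θ in Ioo (0 : ℝ) (2 * Real.pi), w (x, θ) with hT
  have hTm : StronglyMeasurable T :=
    StronglyMeasurable.integral_prod_right (f := fun x θ => w (x, θ)) hw.stronglyMeasurable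
  have hTc : ContinuousAt T k := by
    refine continuousAt_of_dominated (bound := fun _ => C) (Eventually.of_forall fun x => ?_)
      (Eventually.of_forall fun x => ae_of_all _ fun θ => hC _) ?_ (ae_of_all _ hcont)
    · exact (hw.comp measurable_prodMk_left).aestronglyMeasurable
    · exact integrable_const _
  have hTb : ∀ x, ‖T x‖ ≤ C * (volume.real (Ioo (0 : ℝ) (2 * Real.pi))) := fun x =>
    norm_setIntegral_le_of_norm_le_const measure_Ioo_lt_top fun θ _ => hC _
  have hA := continuous_amplitude_zero N ψ k l
  have hint : IntegrableOn (fun x => (amplitude N ψ k l 0 x : ℂ) * T x) (Icc (0 : ℝ) N) := by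
    refine Integrable.mul_bdd (c := C * (volume.real (Ioo (0 : ℝ) (2 * Real.pi)))) ?_
      hTm.aestronglyMeasurable (ae_of_all _ hTb)
    exact (Complex.continuous_ofReal.comp hA).continuousOn.integrableOn_compact isCompact_Icc
  have hlim := tendsto_setIntegral_exp_smul_of_unique_maximum (μ := volume) isCompact_Icc
    (x₀ := (k : ℝ)) (fun u hu hku => ?_)
    (contDiffOn_exponent h.nat_pos h.smooth k).continuousOn
    (fun y hy hne => h.exponent_lt_of_mem_Ioo hk hy hne) (Ioo_subset_Icc_self hk') hint
    ((Complex.continuous_ofReal.comp hA).continuousAt.mul hTc).continuousWithinAt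
  · refine hlim.congr fun s => ?_
    congr 1
    have hints : IntegrableOn (fun q => (amplitude N ψ k l s q.1 : ℂ) * w q) (coordRect N) := by
      obtain ⟨B, hB⟩ := (isCompact_Icc (a := (0 : ℝ)) (b := N)).exists_bound_of_continuousOn
        (contDiffOn_exponent h.nat_pos h.smooth k).continuousOn
      have hexp : AEStronglyMeasurable (fun q : ℝ × ℝ => Real.exp (s * exponent N ψ k q.1))
          (volume.restrict (coordRect N)) :=
        Real.continuous_exp.comp_aestronglyMeasurable
          ((aestronglyMeasurable_exponent_fst h k).const_mul s)
      refine ((integrableOn_amplitude_mul N ψ k l hw hC).bdd_smul (Real.exp (|s| * B))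
        hexp ?_).congr (ae_of_all _ fun q => ?_)
      · filter_upwards [ae_restrict_mem (isOpen_coordRect N).measurableSet] with q hq
        rw [Real.norm_of_nonneg (Real.exp_pos _).le, Real.exp_le_exp]
        refine (le_abs_self _).trans ?_
        rw [abs_mul]
        exact mul_le_mul_of_nonneg_left (hB q.1 (Ioo_subset_Icc_self hq.1)) (abs_nonneg s)
      · simp only [amplitude_eq N ψ k l s, Pi.smul_apply', Complex.real_smul]
        push_cast
        ring
    rw [coordIntegral, coordRect, Measure.volume_eq_prod, setIntegral_prod _ hints,
      integral_Icc_eq_integral_Ioo]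
    congr 1
    ext x
    simp only [hT, amplitude_eq N ψ k l s]
    rw [integral_const_mul, Complex.real_smul]
    push_cast
    ring
  · refine lt_of_lt_of_le ((hu.inter isOpen_Ioo).measure_pos volume ⟨(k : ℝ), hku, hk'⟩)
      (measure_mono (inter_subset_inter_right u Ioo_subset_Icc_self))

end Limits

end ToricSphere

theorem mainTheorem1 (N : ℕ) (m α : ℝ) (ψ : ℝ → ℝ)
    (hψ : ToricSphere.IsBumpPotential N m α ψ)
    (n : ℤ) (hn : (n : ℝ) ∈ Icc (0 : ℝ) N) :
    (∀ s : ℝ, 0 ≤ s →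
      ToricSphere.IsSmoothSection N (ToricSphere.sigma N ψ s n) ∧
      ToricSphere.IsHolomorphicSection N (ToricSphere.gRay N ψ s)
        (ToricSphere.sigma N ψ s n)) ∧
    ∀ U : Set ToricSphere.S2, IsOpen U →
      ((n : ℝ) ∈ interior (Icc (m - α) (m + α)) →
        ∀ τ : ToricSphere.TestSection N U,
          Tendsto (fun s : ℝ => ToricSphere.iota N U (ToricSphere.xi N ψ s n) τ) atTop
            (𝓝 (ToricSphere.dirac N U n τ))) ∧
      (∀ Q : Set ℝ, Q = Icc 0 (m - α) ∨ Q = Icc (m + α) N → (n : ℝ) ∈ Q →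
        ∀ τ : ToricSphere.TestSection N U,
          Tendsto (fun s : ℝ => ToricSphere.iota N U (ToricSphere.xi N ψ s n) τ) atTop
            (𝓝 (ToricSphere.iota N U (ToricSphere.normalizedRestriction N ψ n Q) τ))) := by
  have hN := hψ.nat_pos
  obtain ⟨k, rfl⟩ : ∃ k : ℕ, n = k := Int.eq_ofNat_of_zero_le (by exact_mod_cast hn.1)
  obtain ⟨l, hl⟩ : ∃ l : ℕ, N = k + l := Nat.exists_eq_add_of_le (by exact_mod_cast hn.2)
  have hkl : k + l = N := hl.symm
  have hsm (s : ℝ) := ToricSphere.isSmoothSection_sigma hψ.smooth hN hkl s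
  refine ⟨fun s hs => ⟨hsm s,
    ToricSphere.isHolomorphicSection_sigma hψ.smooth hN hkl s hs hψ.nonneg⟩, fun U _ => ?_⟩
  have hxi (τ : ToricSphere.TestSection N U) (s : ℝ) :
      ToricSphere.iota N U (ToricSphere.xi N ψ s k) τ =
        ToricSphere.coordIntegral N (ToricSphere.amplitude N ψ k l s)
          (ToricSphere.pairing N k τ) /
        ToricSphere.coordIntegral N (ToricSphere.amplitude N ψ k l s) 1 :=
    ToricSphere.iota_div_l1Norm τ (hsm s).measurable
      (ToricSphere.amplitude_nonneg N ψ k l s)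
      fun x hx θ => ToricSphere.sigma_actionAngle hψ.smooth hN hkl s hx θ
  simp only [Int.cast_natCast] at hn ⊢
  constructor
  · intro hk τ
    rw [interior_Icc] at hk
    have hk' : (k : ℝ) ∈ Ioo (0 : ℝ) N :=
      ⟨by linarith [hk.1, hψ.left_mem], by linarith [hk.2, hψ.right_mem]⟩
    have hA : (ToricSphere.amplitude N ψ k l 0 k : ℂ) ≠ 0 := by
      exact_mod_cast (ToricSphere.amplitude_zero_pos ψ k l hk').ne'
    obtain ⟨C, hC⟩ := ToricSphere.exists_bound_pairing N k τ
    have hnum := ToricSphere.tendsto_coordIntegral_of_mem_Ioo (l := l) hψ hk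
      (ToricSphere.measurable_pairing N k τ) hC fun θ => by
        obtain ⟨-, hnorth⟩ := ToricSphere.actionAngle_ne_poles θ hk' hN
        have hτ := τ.smooth.1.continuousOn.continuousAt (isOpen_compl_singleton.mem_nhds hnorth)
        have haa : ContinuousAt (fun x : ℝ => ToricSphere.actionAngle N x θ) k :=
          ((ToricSphere.continuous_actionAngle N).comp (by fun_prop :
            Continuous fun x : ℝ => (x, θ))).continuousAt
        exact continuousAt_const.mul (ContinuousAt.comp (f := fun x : ℝ =>
          ToricSphere.actionAngle N x θ) hτ haa)
    have hden := ToricSphere.tendsto_coordIntegral_of_mem_Ioo (l := l) hψ hk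
      (w := 1) measurable_const (C := 1) (fun q => by simp) fun θ => continuousAt_const
    have hvol : ∫ θ in Ioo (0 : ℝ) (2 * Real.pi), (1 : ℝ × ℝ → ℂ) ((k : ℝ), θ)
        = 2 * Real.pi := by
      simp [Real.pi_pos.le]
    rw [hvol] at hden
    have hpi : (2 * Real.pi : ℂ) ≠ 0 := by exact_mod_cast Real.two_pi_pos.ne'
    have hlim := hnum.div hden (mul_ne_zero hA hpi)
    rw [mul_div_mul_left _ _ hA] at hlim
    have hdirac : ToricSphere.dirac N U k τ =
        (∫ θ in Ioo (0 : ℝ) (2 * Real.pi), ToricSphere.pairing N k τ ((k : ℝ), θ))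
          / (2 * Real.pi) := by
      rw [ToricSphere.dirac, intervalIntegral.integral_of_le Real.two_pi_pos.le,
        integral_Ioc_eq_integral_Ioo, one_div_mul_eq_div]
      simp only [ToricSphere.pairing, Int.cast_natCast]
    rw [hdirac]
    refine hlim.congr fun s => ?_
    rw [hxi τ s, Pi.div_apply, Complex.real_smul, Complex.real_smul]
    refine mul_div_mul_left _ _ ?_
    have hpos : 0 < ∫ x in Icc (0 : ℝ) N, Real.exp (s * ToricSphere.exponent N ψ k x) := by
      have : NeZero (volume.restrict (Icc (0 : ℝ) N)) := ⟨by simp [hN.ne']⟩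
      exact integral_exp_pos ((continuousOn_const.mul (ToricSphere.contDiffOn_exponent hN
        hψ.smooth k).continuousOn).rexp.integrableOn_compact isCompact_Icc)
    exact_mod_cast (inv_pos.2 hpos).ne'
  · intro Q hQ hk τ
    have hQm : MeasurableSet Q := by rcases hQ with rfl | rfl <;> exact measurableSet_Icc
    obtain ⟨C, hC⟩ := ToricSphere.exists_bound_pairing N k τ
    have hnum := ToricSphere.tendsto_coordIntegral_of_mem (l := l) hψ hQ hk
      (ToricSphere.measurable_pairing N k τ) hC
    have hden := ToricSphere.tendsto_coordIntegral_of_mem (l := l) hψ hQ hk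
      (w := 1) measurable_const (C := 1) fun q => by simp
    have hmeas : MeasurableSet (ToricSphere.moment N ⁻¹' Q) :=
      (ToricSphere.contMDiff_moment N).continuous.measurable hQm
    have hrestr : ToricSphere.iota N U (ToricSphere.normalizedRestriction N ψ k Q) τ =
        ToricSphere.coordIntegral N (Q.indicator (ToricSphere.amplitude N ψ k l 0))
          (ToricSphere.pairing N k τ) /
        ToricSphere.coordIntegral N (Q.indicator (ToricSphere.amplitude N ψ k l 0)) 1 := by
      rw [← ToricSphere.iota_div_l1Norm τ ((hsm 0).measurable.indicator hmeas)
        (indicator_nonneg fun x _ => ToricSphere.amplitude_nonneg N ψ k l 0 x) fun x hx θ => ?_]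
      · unfold ToricSphere.normalizedRestriction
        have hnorm : ToricSphere.l1Norm N (ToricSphere.moment N ⁻¹' Q)
            (ToricSphere.sigma N ψ 0 k) = ToricSphere.l1Norm N univ
              ((ToricSphere.moment N ⁻¹' Q).indicator (ToricSphere.sigma N ψ 0 k)) := by
          simp only [ToricSphere.l1Norm, Measure.restrict_univ,
            norm_indicator_eq_indicator_norm, integral_indicator hmeas]
        rw [hnorm]
      · have hmom := ToricSphere.moment_actionAngle θ (Ioo_subset_Icc_self hx) hN
        by_cases hxQ : x ∈ Q
        · rw [indicator_of_mem (by rwa [mem_preimage, hmom]), indicator_of_mem hxQ,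
            ToricSphere.sigma_actionAngle hψ.smooth hN hkl 0 hx θ]
        · rw [indicator_of_notMem (by rwa [mem_preimage, hmom]), indicator_of_notMem hxQ,
            Complex.ofReal_zero, zero_mul]
    rw [hrestr]
    refine (hnum.div hden (ToricSphere.coordIntegral_indicator_ne_zero hψ hQ)).congr fun s => ?_
    rw [hxi τ s]
    exact mul_div_mul_left _ _ (by exact_mod_cast (Real.exp_pos _).ne')
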